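/- Let $C,G,M>0$ and $Y\in(1,2)$, and let $X=(X_t)_{t\ge 0}$ be a CGMY process with these parameters, i.e. a real-valued Lévy process with generating triplet $(\sigma^2,b,\nu)=(0,b,\nu)$ for some $b\in\mathbb R$, where $\nu$ has the density $$\nu(x)=\frac{C e^{-Mx}}{x^{1+Y}}\mathbf 1_{\{x>0\}}+\frac{C e^{Gx}}{|x|^{1+Y}}\mathbf 1_{\{x<0\}},$$ so that $$\mathbb E\,e^{iuX_t}=\exp\Big[t\Big(iub+\int_{\mathbb R}\big(e^{iux}-1-iux\mathbf 1_{\{|x|\le 1\}}\big)\nu(x)\,dx\Big)\Big]\qquad(t\ge 0,\ u\in\mathbb R).$$ Then, as $t\to 0^+$, $X_t/t^{1/Y}$ converges weakly to the law of a random variable $Z$ that is symmetric $Y$-stable with scale parameter $c=\big(2C\,\Gamma(-Y)\,|\cos(\tfrac12 Y\pi)|\big)^{1/Y}>0$. That is, the law of $Z$ is a nondegenerate $Y$-stable law, symmetric about $0$, with characteristic function $$\mathbb E\,e^{iuZ}=\exp(-|cu|^Y)=\exp\big(-2C\,\Gamma(-Y)\,|\cos(\tfrac12 Y\pi)|\,|u|^{Y}\big),\qquad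 u\in\mathbb R.$$ Moreover, for every $x\in\mathbb R$, $$\lim_{t\to 0^+}\mathbb P\big(X_t/t^{1/Y}>x\big)=\mathbb P(Z>x).$$ -/

import Mathlib

open MeasureTheory ProbabilityTheory Filter Topology
open scoped NNReal ENNReal

/-- A real-valued Lévy process `X = (X t)` for `t ≥ 0` on `(Ω, P)`: it starts at `0`, has
independent and stationary increments, is continuous in probability and has càdlàg paths
(the path properties being required almost surely). -/
structure IsLevyProcess {Ω : Type*} [MeasurableSpace Ω] (X : ℝ≥0 → Ω → ℝ)
    (P : Measure Ω) : Prop where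
  measurable : ∀ t, Measurable (X t)
  zero : ∀ᵐ ω ∂P, X 0 ω = 0
  indep : HasIndepIncrements X P
  stationary : ∀ s t : ℝ≥0, IdentDistrib (fun ω => X (s + t) ω - X s ω) (X t) P P
  stochCont : ∀ t, TendstoInMeasure P X (𝓝 t) (X t)
  cadlag : ∀ᵐ ω ∂P, ∀ t : ℝ≥0,
    ContinuousWithinAt (fun s => X s ω) (Set.Ici t) t ∧
      ∃ l : ℝ, Tendsto (fun s => X s ω) (𝓝[<] t) (𝓝 l)

/-- A Lévy measure on `ℝ`: no mass at `0`, and `∫ min(1, x²) ν(dx) < ∞`. -/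
structure IsLevyMeasure (ν : Measure ℝ) : Prop where
  zero : ν {0} = 0
  lintegral_lt_top : ∫⁻ x, ENNReal.ofReal (min 1 (x ^ 2)) ∂ν < ∞

/-- The characteristic exponent of the triplet `(σ², b, ν)` (with `v = σ²`),
`ψ(u) = i b u - σ² u² / 2 + ∫ (exp(i u x) - 1 - i u x 1_{|x| ≤ 1}) ν(dx)`. -/
noncomputable def levyExponent (v : ℝ≥0) (b : ℝ) (ν : Measure ℝ) (u : ℝ) : ℂ :=
  Complex.I * b * u - (v : ℝ) * (u : ℂ) ^ 2 / 2 +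
    ∫ x : ℝ, (Complex.exp (Complex.I * u * x) - 1 -
      (if |x| ≤ 1 then Complex.I * u * x else 0)) ∂ν

/-- `X` is a Lévy process with generating triplet `(σ², b, ν)` (with `v = σ²`), the truncation
function being the indicator of `[-1, 1]`. -/
structure HasLevyTriplet {Ω : Type*} [MeasurableSpace Ω] (X : ℝ≥0 → Ω → ℝ) (P : Measure Ω)
    (v : ℝ≥0) (b : ℝ) (ν : Measure ℝ) : Prop where
  isLevyProcess : IsLevyProcess X P
  isLevyMeasure : IsLevyMeasure ν
  charFun_eq : ∀ (t : ℝ≥0) (u : ℝ),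
    charFun (P.map (X t)) u = Complex.exp ((t : ℝ) * levyExponent v b ν u)

/-- The CGMY Lévy density: `C exp(-M x) / x^(1+Y)` for `x > 0` and
`C exp(G x) / |x|^(1+Y)` for `x < 0`. -/
noncomputable def cgmyDensity (C G M Y x : ℝ) : ℝ :=
  if 0 < x then C * Real.exp (-M * x) / x ^ (1 + Y)
  else if x < 0 then C * Real.exp (G * x) / |x| ^ (1 + Y)
  else 0

/-- The CGMY Lévy measure. -/
noncomputable def cgmyMeasure (C G M Y : ℝ) : Measure ℝ :=
  volume.withDensity fun x => ENNReal.ofReal (cgmyDensity C G M Y x)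

/-- The CGMY measure is a Lévy measure, so the corresponding clause of `HasLevyTriplet` is no
restriction on the parameters. -/
theorem isLevyMeasure_cgmyMeasure {C G M Y : ℝ} (hC : 0 < C) (hG : 0 < G) (hM : 0 < M)
    (hY : Y ∈ Set.Ioo (1 : ℝ) 2) : IsLevyMeasure (cgmyMeasure C G M Y) := by
  obtain ⟨hY1, hY2⟩ := hY
  refine ⟨?_, ?_⟩
  · exact withDensity_absolutelyContinuous _ _ (by simp)
  set g : ℝ → ℝ := fun x => C * min (x ^ (1 - Y)) (x ^ (-(1 + Y))) with hg
  have hgm : Measurable g := by fun_prop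
  have hg0 : ∀ x, 0 < x → 0 ≤ g x := fun x hx => by positivity
  have hg1 : IntegrableOn g (Set.Ioi 0) := by
    rw [← Set.Ioc_union_Ioi_eq_Ioi zero_le_one, integrableOn_union]
    constructor
    · have h1 : IntegrableOn (fun x : ℝ => C * x ^ (1 - Y)) (Set.Ioc 0 1) :=
        ((intervalIntegrable_iff_integrableOn_Ioc_of_le zero_le_one).1
          (intervalIntegral.intervalIntegrable_rpow' (by linarith))).const_mul C
      refine h1.mono' hgm.aestronglyMeasurable ?_
      filter_upwards [ae_restrict_mem measurableSet_Ioc] with x hx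
      rw [Real.norm_of_nonneg (hg0 x hx.1)]
      exact mul_le_mul_of_nonneg_left (min_le_left _ _) hC.le
    · have h1 : IntegrableOn (fun x : ℝ => C * x ^ (-(1 + Y))) (Set.Ioi 1) :=
        (integrableOn_Ioi_rpow_of_lt (by linarith) one_pos).const_mul C
      refine h1.mono' hgm.aestronglyMeasurable ?_
      filter_upwards [ae_restrict_mem measurableSet_Ioi] with x hx
      have hx0 : (0 : ℝ) < x := one_pos.trans hx
      rw [Real.norm_of_nonneg (hg0 x hx0)]
      exact mul_le_mul_of_nonneg_left (min_le_right _ _) hC.le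
  have hf : IntegrableOn (fun x => g |x|) (Set.Ioi 0) :=
    hg1.congr_fun (fun x hx => by simp only [abs_of_pos (Set.mem_Ioi.1 hx)]) measurableSet_Ioi
  have hf' : IntegrableOn (fun x => g |x|) (Set.Iic 0) := by
    rw [← Measure.map_neg_eq_self (volume : Measure ℝ)]
    let m : MeasurableEmbedding fun x : ℝ => -x := (Homeomorph.neg ℝ).measurableEmbedding
    rw [m.integrableOn_map_iff]
    simp_rw [Function.comp_def, abs_neg, Set.neg_preimage, Set.neg_Iic, neg_zero]
    exact Iff.mpr integrableOn_Ici_iff_integrableOn_Ioi hf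
  have hint : Integrable (fun x => g |x|) := by
    rw [← integrableOn_univ, ← Set.Iic_union_Ioi (a := (0 : ℝ))]
    exact hf'.union hf
  have hdm : Measurable (fun x => ENNReal.ofReal (cgmyDensity C G M Y x)) := by
    unfold cgmyDensity
    refine ENNReal.measurable_ofReal.comp ?_
    refine Measurable.ite measurableSet_Ioi (by fun_prop) ?_
    exact Measurable.ite measurableSet_Iio (by fun_prop) measurable_const
  have key : ∀ r e : ℝ, 0 < r → 0 ≤ e → e ≤ 1 →
      C * e / r ^ (1 + Y) * min 1 (r ^ 2) ≤ g r := by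
    intro r e hr he he1
    have h2 : r ^ (1 - Y) = r ^ (-(1 + Y)) * r ^ 2 := by
      rw [← Real.rpow_natCast, ← Real.rpow_add hr]; norm_num; ring_nf
    have hp : 0 < r ^ (-(1 + Y)) := Real.rpow_pos_of_pos hr _
    have h3 : g r = C * (r ^ (-(1 + Y)) * min 1 (r ^ 2)) := by
      simp only [hg]
      rw [h2, mul_min_of_nonneg _ _ hp.le, mul_one, min_comm]
    rw [h3, div_eq_mul_inv, ← Real.rpow_neg hr.le]
    have hm : 0 ≤ min 1 (r ^ 2) := by positivity
    nlinarith [mul_nonneg (mul_nonneg hC.le (mul_nonneg hp.le hm)) (sub_nonneg.2 he1)]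
  unfold cgmyMeasure
  rw [lintegral_withDensity_eq_lintegral_mul _ hdm (by fun_prop)]
  refine lt_of_le_of_lt (lintegral_mono fun x => ?_) hint.lintegral_lt_top
  have hm : 0 ≤ min 1 (x ^ 2) := by positivity
  simp only [Pi.mul_apply]
  rw [← ENNReal.ofReal_mul' hm]
  refine ENNReal.ofReal_le_ofReal ?_
  unfold cgmyDensity
  split_ifs with h h'
  · rw [abs_of_pos h]
    exact key x _ h (Real.exp_pos _).le (Real.exp_le_one_iff.2 (by nlinarith))
  · rw [← sq_abs x]
    exact key |x| _ (abs_pos.2 h'.ne) (Real.exp_pos _).le (Real.exp_le_one_iff.2 (by nlinarith))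
  · have : x = 0 := le_antisymm (not_lt.1 h) (not_lt.1 h')
    subst this
    simp [hg, Real.zero_rpow (by linarith : 1 - Y ≠ 0)]
    positivity

/-- A CGMY process: a pure-jump Lévy process (no Gaussian part, arbitrary `b`) whose Lévy
measure is the CGMY measure. -/
def IsCGMYProcess {Ω : Type*} [MeasurableSpace Ω] (X : ℝ≥0 → Ω → ℝ) (P : Measure Ω)
    (C G M Y : ℝ) : Prop :=
  ∃ b : ℝ, HasLevyTriplet X P 0 b (cgmyMeasure C G M Y)

/-- A (nondegenerate) `α`-stable law on `ℝ`: if `Z₁, Z₂, Z` have law `μ` with `Z₁, Z₂`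
independent, then for all `p, q > 0` there is a constant `d` such that `p Z₁ + q Z₂` and
`(p^α + q^α)^(1/α) Z + d` have the same law. -/
def IsStableLaw (α : ℝ) (μ : Measure ℝ) : Prop :=
  (∀ x : ℝ, μ ≠ Measure.dirac x) ∧
    ∀ p q : ℝ, 0 < p → 0 < q → ∃ d : ℝ,
      (μ.prod μ).map (fun z : ℝ × ℝ => p * z.1 + q * z.2) =
        μ.map (fun z : ℝ => (p ^ α + q ^ α) ^ (1 / α) * z + d)

/-- A symmetric `α`-stable law with scale parameter `c > 0`: an `α`-stable law, invariant under
`z ↦ -z`, with characteristic function `exp(-|c u|^α)`. -/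
structure IsSymmetricStableLaw (α c : ℝ) (μ : Measure ℝ) : Prop where
  stable : IsStableLaw α μ
  symm : μ.map (fun z : ℝ => -z) = μ
  scale_pos : 0 < c
  charFun_eq : ∀ u : ℝ, charFun μ u = Complex.exp (-((|c * u| ^ α : ℝ) : ℂ))

/-! Put `h = t^(1/Y)`, so that `t = h^Y`. The characteristic function of `X_t / h` at `u` is `exp
(h^Y ψ(u/h))`, with `ψ` the Lévy exponent. Substituting `x = h y` in the Lévy integral, the
homogeneity of `|x|^(-1-Y)` absorbs the factor `h^Y`. Only three traces of `h` remain: the tempering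
rates become `G h` and `M h`, the truncation level becomes `1/h`, and the drift is multiplied by
`h^(Y-1)`. As `h → 0` tempering, truncation and drift all disappear
(`rpow_mul_levyExponent_cgmyMeasure`, `tendsto_integral_compensatedExp`).

What is left is the fully compensated integral against the symmetric density `C |y|^(-1-Y)`. By
symmetry it reduces to `∫ (1 - cos y) y^(-1-Y)` over the half-line, which Gamma integrals and the
reflection formula evaluate as `Γ(-Y) |cos(πY/2)|`.

The limit law is not assumed to exist: Lévy's continuity theorem produces it from the pointwise
limit of the characteristic functions and also gives the weak convergence. Its characteristic
function is integrable, so it has no atoms, and the portmanteau theorem gives convergence of every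
tail. -/

/-! ### The constant: evaluation of `∫ (1 - cos y) y^(-1-Y)`. -/

/-- Tonelli for nonnegative functions on the positive quadrant, in Bochner form: joint
integrability is not required. -/
theorem integral_Ioi_swap_of_nonneg {f : ℝ → ℝ → ℝ} (hm : Measurable (Function.uncurry f))
    (h0 : ∀ x > 0, ∀ y > 0, 0 ≤ f x y)
    (h1 : ∀ x > 0, IntegrableOn (f x) (Set.Ioi 0))
    (h2 : ∀ y > 0, IntegrableOn (fun x => f x y) (Set.Ioi 0)) :
    ∫ x in Set.Ioi 0, ∫ y in Set.Ioi 0, f x y = ∫ y in Set.Ioi 0, ∫ x in Set.Ioi 0, f x y := by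
  have hm' : Measurable (Function.uncurry fun y x => f x y) := hm.comp measurable_swap
  rw [integral_eq_lintegral_of_nonneg_ae, integral_eq_lintegral_of_nonneg_ae]
  · congr 1
    have e1 : ∫⁻ x in Set.Ioi 0, ENNReal.ofReal (∫ y in Set.Ioi 0, f x y)
        = ∫⁻ x in Set.Ioi 0, ∫⁻ y in Set.Ioi 0, ENNReal.ofReal (f x y) := by
      refine setLIntegral_congr_fun measurableSet_Ioi fun x hx => ?_
      refine ofReal_integral_eq_lintegral_ofReal (h1 x hx) ?_
      filter_upwards [ae_restrict_mem measurableSet_Ioi] with y hy using h0 x hx y hy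
    have e2 : ∫⁻ y in Set.Ioi 0, ENNReal.ofReal (∫ x in Set.Ioi 0, f x y)
        = ∫⁻ y in Set.Ioi 0, ∫⁻ x in Set.Ioi 0, ENNReal.ofReal (f x y) := by
      refine setLIntegral_congr_fun measurableSet_Ioi fun y hy => ?_
      refine ofReal_integral_eq_lintegral_ofReal (h2 y hy) ?_
      filter_upwards [ae_restrict_mem measurableSet_Ioi] with x hx using h0 x hx y hy
    rw [e1, e2]
    exact lintegral_lintegral_swap (hm.ennreal_ofReal.aemeasurable)
  · filter_upwards [ae_restrict_mem measurableSet_Ioi] with y hy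
    exact setIntegral_nonneg measurableSet_Ioi fun x hx => h0 x hx y hy
  · exact (hm'.stronglyMeasurable.integral_prod_right).aestronglyMeasurable
  · filter_upwards [ae_restrict_mem measurableSet_Ioi] with x hx
    exact setIntegral_nonneg measurableSet_Ioi fun y hy => h0 x hx y hy
  · exact (hm.stronglyMeasurable.integral_prod_right).aestronglyMeasurable

theorem integrableOn_rpow_mul_exp_neg_mul {s b : ℝ} (hs : -1 < s) (hb : 0 < b) :
    IntegrableOn (fun x : ℝ => x ^ s * Real.exp (-(b * x))) (Set.Ioi 0) := by
  simpa using integrableOn_rpow_mul_exp_neg_mul_rpow hs one_pos hb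

theorem integrableOn_one_sub_cos_mul_exp {s : ℝ} (hs : 0 < s) :
    IntegrableOn (fun y : ℝ => (1 - Real.cos y) * Real.exp (-(s * y))) (Set.Ioi 0) := by
  have h := (integrableOn_exp_mul_Ioi (neg_lt_zero.2 hs) 0)
  refine (h.const_mul 2).mono' (by fun_prop) (ae_of_all _ fun y => ?_)
  have h1 := Real.cos_le_one y
  have h2 := Real.neg_one_le_cos y
  rw [norm_mul, Real.norm_of_nonneg (by linarith), Real.norm_of_nonneg (Real.exp_pos _).le,
    neg_mul]
  exact mul_le_mul_of_nonneg_right (by linarith) (Real.exp_pos _).le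

theorem integral_one_sub_cos_mul_exp {s : ℝ} (hs : 0 < s) :
    ∫ y in Set.Ioi (0 : ℝ), (1 - Real.cos y) * Real.exp (-(s * y)) = 1 / (s * (1 + s ^ 2)) := by
  have hre : ((-s : ℂ) + Complex.I).re < 0 := by simpa using hs
  have h1 := integrableOn_exp_mul_Ioi (neg_lt_zero.2 hs) 0
  have h2 := integrableOn_exp_mul_complex_Ioi hre 0
  have e2 : ∫ y in Set.Ioi (0 : ℝ), (Complex.exp (((-s : ℂ) + Complex.I) * y)).re
      = s / (1 + s ^ 2) := by
    have := integral_re h2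
    simp only [RCLike.re_to_complex] at this
    rw [this, integral_exp_mul_complex_Ioi hre]
    simp [Complex.inv_re, Complex.normSq_apply, neg_div]
    field_simp
    ring
  have hr : ∀ y : ℝ, (Complex.exp (((-s : ℂ) + Complex.I) * y)).re
      = Real.cos y * Real.exp (-(s * y)) := fun y => by
    rw [Complex.exp_re]; simp [mul_comm]
  have e1 := integral_exp_mul_Ioi (neg_lt_zero.2 hs) 0
  calc _ = ∫ y in Set.Ioi (0 : ℝ), (Real.exp (-s * y)
        - (Complex.exp (((-s : ℂ) + Complex.I) * y)).re) := by
        congr 1; ext y; rw [hr, neg_mul]; ring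
    _ = _ := by
        have h2re : IntegrableOn (fun y : ℝ => (Complex.exp (((-s : ℂ) + Complex.I) * y)).re)
          (Set.Ioi 0) := h2.re
        rw [integral_sub h1 h2re, e1, e2]
        simp
        field_simp
        ring

/-- Write `1/(1+s²)` as `∫ exp(-(1+s²) r) dr` and swap. The `s`-integral gives `Γ(a/2) r^(-a/2) /
2`, the `r`-integral then gives `Γ(1 - a/2)`, and Euler's reflection formula finishes. -/
theorem integral_rpow_div_one_add_sq {a : ℝ} (ha : 0 < a) (ha2 : a < 2) :
    ∫ s in Set.Ioi (0 : ℝ), s ^ (a - 1) * (1 / (1 + s ^ 2))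
      = Real.pi / (2 * Real.sin (Real.pi * a / 2)) := by
  have e0 : ∀ s : ℝ, ∫ r in Set.Ioi (0 : ℝ), s ^ (a - 1) * Real.exp (-((1 + s ^ 2) * r))
      = s ^ (a - 1) * (1 / (1 + s ^ 2)) := fun s => by
    have := integral_exp_mul_Ioi (neg_lt_zero.2 (by positivity : 0 < 1 + s ^ 2)) 0
    rw [integral_const_mul]
    congr 1
    simp only [neg_mul] at this
    rw [this, mul_zero, neg_zero, Real.exp_zero, neg_div_neg_eq]
  have e1 : ∀ r > 0, ∫ s in Set.Ioi (0 : ℝ), s ^ (a - 1) * Real.exp (-((1 + s ^ 2) * r))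
      = (1 / 2 * Real.Gamma (a / 2)) * (r ^ ((1 - a / 2) - 1) * Real.exp (-(1 * r))) :=
      fun r hr => by
    have := integral_rpow_mul_exp_neg_mul_rpow two_pos (by linarith : -1 < a - 1) hr
    calc _ = ∫ s in Set.Ioi (0 : ℝ), Real.exp (-r) *
          (s ^ (a - 1) * Real.exp (-r * s ^ (2 : ℝ))) := by
          congr 1; ext s
          rw [mul_left_comm, ← Real.exp_add, Real.rpow_two]; ring_nf
      _ = _ := by
          rw [integral_const_mul, this]
          ring_nf
  calc _ = ∫ s in Set.Ioi (0 : ℝ), ∫ r in Set.Ioi (0 : ℝ),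
        s ^ (a - 1) * Real.exp (-((1 + s ^ 2) * r)) := by simp_rw [e0]
    _ = ∫ r in Set.Ioi (0 : ℝ), ∫ s in Set.Ioi (0 : ℝ),
        s ^ (a - 1) * Real.exp (-((1 + s ^ 2) * r)) := by
        refine integral_Ioi_swap_of_nonneg (by fun_prop) (fun x hx y _ => ?_) (fun x hx => ?_)
          fun y hy => ?_
        · have := Real.rpow_nonneg (le_of_lt hx) (a - 1); positivity
        · have := integrableOn_exp_mul_Ioi (neg_lt_zero.2 (by positivity : 0 < 1 + x ^ 2)) 0
          simp only [neg_mul] at this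
          exact this.const_mul _
        · have := (integrableOn_rpow_mul_exp_neg_mul_rpow (by linarith : -1 < a - 1) two_pos
            hy).const_mul (Real.exp (-y))
          refine IntegrableOn.congr_fun this (fun s _ => ?_) measurableSet_Ioi
          rw [mul_left_comm, ← Real.exp_add, Real.rpow_two]; ring_nf
    _ = ∫ r in Set.Ioi (0 : ℝ),
        (1 / 2 * Real.Gamma (a / 2)) * (r ^ ((1 - a / 2) - 1) * Real.exp (-(1 * r))) :=
        setIntegral_congr_fun measurableSet_Ioi e1
    _ = _ := by
        rw [integral_const_mul, Real.integral_rpow_mul_exp_neg_mul_Ioi (by linarith) one_pos]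
        have := Real.Gamma_mul_Gamma_one_sub (a / 2)
        rw [div_one, Real.one_rpow, one_mul, mul_assoc, this, mul_div_assoc Real.pi a 2]
        rw [one_div, mul_comm, ← div_eq_mul_inv, div_div, mul_comm (Real.sin _)]

/-- Write `Γ(1+Y) y^(-1-Y)` as `∫ s^Y exp(-ys) ds` and swap: the inner integral becomes the Laplace
transform of `1 - cos`. -/
theorem integral_one_sub_cos_mul_rpow {Y : ℝ} (hY : 0 < Y) (hY2 : Y < 2) :
    Real.Gamma (1 + Y) * ∫ y in Set.Ioi (0 : ℝ), (1 - Real.cos y) * (1 / y ^ (1 + Y))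
      = Real.pi / (2 * Real.sin (Real.pi * Y / 2)) := by
  have e0 : ∀ y > 0, ∫ s in Set.Ioi (0 : ℝ), (1 - Real.cos y) * (s ^ Y * Real.exp (-(y * s)))
      = Real.Gamma (1 + Y) * ((1 - Real.cos y) * (1 / y ^ (1 + Y))) := fun y hy => by
    have := Real.integral_rpow_mul_exp_neg_mul_Ioi (by linarith : 0 < 1 + Y) hy
    rw [add_sub_cancel_left] at this
    rw [integral_const_mul, this, Real.div_rpow zero_le_one hy.le, Real.one_rpow]
    ring
  have e1 : ∀ s > 0, ∫ y in Set.Ioi (0 : ℝ), (1 - Real.cos y) * (s ^ Y * Real.exp (-(y * s)))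
      = s ^ (Y - 1) * (1 / (1 + s ^ 2)) := fun s hs => by
    have := integral_one_sub_cos_mul_exp hs
    simp_rw [mul_left_comm _ (s ^ Y), mul_comm _ s]
    rw [integral_const_mul, this, Real.rpow_sub_one hs.ne']
    field_simp
  rw [← integral_const_mul, ← integral_rpow_div_one_add_sq hY hY2,
    ← setIntegral_congr_fun measurableSet_Ioi e0, ← setIntegral_congr_fun measurableSet_Ioi e1]
  refine integral_Ioi_swap_of_nonneg (by fun_prop) (fun y _ s hs => ?_) (fun y hy => ?_)
    fun s hs => ?_
  · have h1 := Real.cos_le_one y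
    have := Real.rpow_nonneg (le_of_lt hs) Y
    exact mul_nonneg (by linarith) (by positivity)
  · exact (integrableOn_rpow_mul_exp_neg_mul (by linarith) hy).const_mul _
  · simp_rw [mul_left_comm _ (s ^ Y), mul_comm _ s]
    exact (integrableOn_one_sub_cos_mul_exp hs).const_mul _

/-- Reflection at `-Y` gives `Γ(-Y) Γ(1+Y) = -π / sin(πY)`, and the double-angle formula cancels the
sine. The cosine is negative for `1 < Y < 2`, hence the absolute value. -/
theorem integral_one_sub_cos_mul_rpow_eq_Gamma {Y : ℝ} (hY1 : 1 < Y) (hY2 : Y < 2) :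
    ∫ y in Set.Ioi (0 : ℝ), (1 - Real.cos y) * (1 / y ^ (1 + Y))
      = Real.Gamma (-Y) * |Real.cos (Y * Real.pi / 2)| := by
  have hG : 0 < Real.Gamma (1 + Y) := Real.Gamma_pos_of_pos (by linarith)
  have hpi := Real.pi_pos
  have hs : 0 < Real.sin (Real.pi * Y / 2) :=
    Real.sin_pos_of_pos_of_lt_pi (by positivity) (by nlinarith)
  have hc : Real.cos (Real.pi * Y / 2) < 0 :=
    Real.cos_neg_of_pi_div_two_lt_of_lt (by nlinarith) (by nlinarith)
  have key := Real.Gamma_mul_Gamma_one_sub (-Y)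
  rw [sub_neg_eq_add, mul_neg, Real.sin_neg, show Real.pi * Y = 2 * (Real.pi * Y / 2) by ring,
    Real.sin_two_mul] at key
  rw [mul_comm Y, abs_of_neg hc]
  refine mul_left_cancel₀ hG.ne' ?_
  rw [integral_one_sub_cos_mul_rpow (by linarith) hY2,
    show Real.Gamma (1 + Y) * (Real.Gamma (-Y) * -Real.cos (Real.pi * Y / 2))
      = (Real.Gamma (-Y) * Real.Gamma (1 + Y)) * -Real.cos (Real.pi * Y / 2) by ring, key]
  have := hc.ne
  field_simp

theorem Gamma_neg_pos {Y : ℝ} (hY1 : 1 < Y) (hY2 : Y < 2) : 0 < Real.Gamma (-Y) := by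
  have h1 := Real.Gamma_add_one (by linarith : -Y ≠ 0)
  have h2 := Real.Gamma_add_one (by linarith : -Y + 1 ≠ 0)
  have h3 : 0 < Real.Gamma (-Y + 1 + 1) := Real.Gamma_pos_of_pos (by linarith)
  rw [h2, h1, ← mul_assoc] at h3
  exact pos_of_mul_pos_right h3 (by nlinarith)

theorem abs_cos_mul_pi_div_two_pos {Y : ℝ} (hY1 : 1 < Y) (hY2 : Y < 2) :
    0 < |Real.cos (Y * Real.pi / 2)| := by
  have hpi := Real.pi_pos
  exact abs_pos.2 (Real.cos_neg_of_pi_div_two_lt_of_lt (by nlinarith) (by nlinarith)).ne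

/-! ### Scaling of the CGMY density and of its Lévy exponent. -/

theorem cgmyDensity_zero_zero (C Y y : ℝ) (hY : 0 < Y) :
    cgmyDensity C 0 0 Y y = C * (1 / |y| ^ (1 + Y)) := by
  unfold cgmyDensity
  split_ifs with h h'
  · simp [abs_of_pos h, div_eq_mul_inv]
  · simp [div_eq_mul_inv]
  · have : y = 0 := le_antisymm (not_lt.1 h) (not_lt.1 h')
    simp [this, Real.zero_rpow (by linarith : 1 + Y ≠ 0)]

theorem cgmyDensity_nonneg {C : ℝ} (hC : 0 ≤ C) (G M Y y : ℝ) : 0 ≤ cgmyDensity C G M Y y := by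
  unfold cgmyDensity
  split_ifs with h h' <;> positivity

theorem cgmyDensity_le {C G M Y : ℝ} (hC : 0 ≤ C) (hG : 0 ≤ G) (hM : 0 ≤ M) (hY : 0 < Y) (y : ℝ) :
    cgmyDensity C G M Y y ≤ C * (1 / |y| ^ (1 + Y)) := by
  rw [← cgmyDensity_zero_zero C Y y hY]
  unfold cgmyDensity
  split_ifs with h h'
  · gcongr
  · have : Real.exp (G * y) ≤ Real.exp (0 * y) := Real.exp_le_exp.2 (by nlinarith)
    gcongr
  · exact le_rfl

theorem measurable_cgmyDensity (C G M Y : ℝ) : Measurable (cgmyDensity C G M Y) := by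
  unfold cgmyDensity
  refine Measurable.ite measurableSet_Ioi (by fun_prop) ?_
  exact Measurable.ite measurableSet_Iio (by fun_prop) measurable_const

/-- The power factor is homogeneous of degree `-(1+Y)`, so zooming in by `h` only slows the
exponential tempering. -/
theorem rpow_mul_cgmyDensity_mul (C G M Y y : ℝ) {h : ℝ} (hh : 0 < h) :
    h ^ (1 + Y) * cgmyDensity C G M Y (h * y) = cgmyDensity C (G * h) (M * h) Y y := by
  have hp := Real.rpow_pos_of_pos hh (1 + Y)
  have hneg : h * y < 0 ↔ y < 0 :=
    ⟨fun hy => by by_contra! hy'; nlinarith, mul_neg_of_pos_of_neg hh⟩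
  unfold cgmyDensity
  simp only [mul_pos_iff_of_pos_left hh, hneg]
  split_ifs with h1 h2
  · rw [Real.mul_rpow hh.le h1.le, ← mul_assoc, neg_mul, neg_mul]
    field_simp
  · rw [abs_mul, abs_of_pos hh, Real.mul_rpow hh.le (abs_nonneg y), ← mul_assoc]
    field_simp
  · simp

theorem tendsto_cgmyDensity_mul (C G M Y y : ℝ) :
    Tendsto (fun h : ℝ => cgmyDensity C (G * h) (M * h) Y y) (𝓝 0)
      (𝓝 (cgmyDensity C 0 0 Y y)) := by
  have hc : Continuous (fun h : ℝ => cgmyDensity C (G * h) (M * h) Y y) := by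
    unfold cgmyDensity
    split_ifs <;> fun_prop
  simpa using hc.tendsto 0

theorem integral_cgmyMeasure {C : ℝ} (hC : 0 ≤ C) (G M Y : ℝ) (f : ℝ → ℂ) :
    ∫ x, f x ∂(cgmyMeasure C G M Y) = ∫ x, cgmyDensity C G M Y x • f x := by
  unfold cgmyMeasure
  rw [integral_withDensity_eq_integral_toReal_smul
    (measurable_cgmyDensity C G M Y).ennreal_ofReal (ae_of_all _ fun _ => ENNReal.ofReal_lt_top)]
  simp_rw [ENNReal.toReal_ofReal (cgmyDensity_nonneg hC G M Y _)]

/-- The truncated compensated exponential, with truncation level `1 / h`. -/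
noncomputable def compensatedExp (h u y : ℝ) : ℂ :=
  Complex.exp (Complex.I * u * y) - 1 - (if |y| ≤ 1 / h then Complex.I * u * y else 0)

theorem measurable_compensatedExp (h u : ℝ) : Measurable (compensatedExp h u) := by
  unfold compensatedExp
  refine Measurable.sub (by fun_prop) (Measurable.ite ?_ (by fun_prop) measurable_const)
  exact measurableSet_le (by fun_prop) measurable_const

/-- Change of variable `x = h y`. Since `Y > 1` in the application, the drift factor `h^(Y-1)` will
vanish with `h`. -/
theorem rpow_mul_levyExponent_cgmyMeasure {C : ℝ} (hC : 0 ≤ C) (G M Y b u : ℝ) {h : ℝ}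
    (hh : 0 < h) :
    ((h ^ Y : ℝ) : ℂ) * levyExponent 0 b (cgmyMeasure C G M Y) (u / h) =
      Complex.I * b * u * ((h ^ (Y - 1) : ℝ) : ℂ) +
        ∫ y, cgmyDensity C (G * h) (M * h) Y y • compensatedExp h u y := by
  have hc : (h : ℂ) ≠ 0 := Complex.ofReal_ne_zero.2 hh.ne'
  unfold levyExponent
  rw [integral_cgmyMeasure hC]
  set g : ℝ → ℂ := fun x => cgmyDensity C G M Y x • (Complex.exp (Complex.I * (u / h : ℝ) * x) - 1 -
      (if |x| ≤ 1 then Complex.I * (u / h : ℝ) * x else 0)) with hg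
  have key : ∀ y, cgmyDensity C (G * h) (M * h) Y y • compensatedExp h u y
      = (h ^ (1 + Y)) • g (h * y) := fun y => by
    rw [← rpow_mul_cgmyDensity_mul C G M Y y hh, hg, ← smul_smul]
    have e : Complex.I * ((u / h : ℝ) : ℂ) * ((h * y : ℝ) : ℂ) = Complex.I * u * y := by
      push_cast; field_simp
    have e2 : |h * y| ≤ 1 ↔ |y| ≤ 1 / h := by
      rw [abs_mul, abs_of_pos hh, le_div_iff₀ hh, mul_comm]
    simp only [e, e2, compensatedExp]
  simp_rw [key]
  rw [integral_smul, Measure.integral_comp_mul_left, abs_of_pos (inv_pos.2 hh), smul_smul,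
    add_comm 1 Y, Real.rpow_add_one hh.ne', mul_inv_cancel_right₀ hh.ne',
    Real.rpow_sub_one hh.ne', Complex.real_smul, mul_add]
  congr 1
  push_cast
  field_simp
  simp
  ring

/-! ### Domination and passage to the stable exponent. -/

theorem norm_exp_I_mul_sub_one_sub_le (u y : ℝ) :
    ‖Complex.exp (Complex.I * u * y) - 1 - Complex.I * u * y‖ ≤ 2 * (u * y) ^ 2 := by
  have hn : ‖Complex.I * u * y‖ = |u * y| := by simp [abs_mul]
  have h1 : ‖Complex.exp (Complex.I * u * y) - 1‖ ≤ |u * y| := by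
    have := @Real.norm_exp_I_mul_ofReal_sub_one_le (u * y)
    rw [mul_assoc]; push_cast at this; simpa using this
  rcases le_total |u * y| 1 with h | h
  · have := Complex.norm_exp_sub_one_sub_id_le (hn.trans_le h)
    rw [hn, sq_abs] at this
    nlinarith [sq_nonneg (u * y)]
  · refine (norm_sub_le _ _).trans ?_
    rw [hn, ← sq_abs]
    nlinarith

theorem norm_compensatedExp_le (h u y : ℝ) : ‖compensatedExp h u y‖ ≤ 2 * |u| * |y| := by
  have hn : ‖Complex.I * u * y‖ = |u * y| := by simp [abs_mul]
  have h1 : ‖Complex.exp (Complex.I * u * y) - 1‖ ≤ |u * y| := by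
    have := @Real.norm_exp_I_mul_ofReal_sub_one_le (u * y)
    rw [mul_assoc]; push_cast at this; simpa using this
  rw [mul_assoc, ← abs_mul]
  unfold compensatedExp
  refine (norm_sub_le _ _).trans ?_
  have : ‖(if |y| ≤ 1 / h then Complex.I * u * y else 0)‖ ≤ |u * y| := by
    split_ifs
    · exact hn.le
    · simpa using mul_nonneg (abs_nonneg u) (abs_nonneg y)
  linarith

theorem norm_compensatedExp_le_sq {h : ℝ} (hh : 0 < h) (h1 : h ≤ 1) (u : ℝ) {y : ℝ}
    (hy : |y| ≤ 1) : ‖compensatedExp h u y‖ ≤ 2 * u ^ 2 * |y| ^ 2 := by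
  have : |y| ≤ 1 / h := hy.trans (by rw [le_div_iff₀ hh]; linarith)
  unfold compensatedExp
  rw [if_pos this]
  refine (norm_exp_I_mul_sub_one_sub_le u y).trans_eq ?_
  rw [sq_abs]; ring

theorem integrable_comp_abs_of_integrableOn {f : ℝ → ℝ} (hf : IntegrableOn f (Set.Ioi 0)) :
    Integrable (fun x => f |x|) := by
  have h1 : IntegrableOn (fun x => f |x|) (Set.Ioi 0) :=
    hf.congr_fun (fun x hx => by simp only [abs_of_pos (Set.mem_Ioi.1 hx)]) measurableSet_Ioi
  have h2 : IntegrableOn (fun x => f |x|) (Set.Iic 0) := by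
    rw [← Measure.map_neg_eq_self (volume : Measure ℝ)]
    let m : MeasurableEmbedding fun x : ℝ => -x := (Homeomorph.neg ℝ).measurableEmbedding
    rw [m.integrableOn_map_iff]
    simp_rw [Function.comp_def, abs_neg, Set.neg_preimage, Set.neg_Iic, neg_zero]
    exact Iff.mpr integrableOn_Ici_iff_integrableOn_Ioi h1
  rw [← integrableOn_univ, ← Set.Iic_union_Ioi (a := (0 : ℝ))]
  exact h2.union h1

theorem integrable_min_rpow_abs {Y : ℝ} (hY1 : 1 < Y) (hY2 : Y < 2) :
    Integrable (fun y : ℝ => min (|y| ^ (1 - Y)) (|y| ^ (-Y))) := by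
  have hm : Measurable (fun y : ℝ => min (y ^ (1 - Y)) (y ^ (-Y))) := by fun_prop
  refine integrable_comp_abs_of_integrableOn (f := fun y : ℝ => min (y ^ (1 - Y)) (y ^ (-Y))) ?_
  have h0 : ∀ y : ℝ, 0 < y → ‖min (y ^ (1 - Y)) (y ^ (-Y))‖ = min (y ^ (1 - Y)) (y ^ (-Y)) :=
    fun y hy => Real.norm_of_nonneg (by positivity)
  rw [← Set.Ioc_union_Ioi_eq_Ioi zero_le_one, integrableOn_union]
  constructor
  · have h1 : IntegrableOn (fun x : ℝ => x ^ (1 - Y)) (Set.Ioc 0 1) :=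
      (intervalIntegrable_iff_integrableOn_Ioc_of_le zero_le_one).1
        (intervalIntegral.intervalIntegrable_rpow' (by linarith))
    refine h1.mono' hm.aestronglyMeasurable ?_
    filter_upwards [ae_restrict_mem measurableSet_Ioc] with x hx
    rw [h0 x hx.1]
    exact min_le_left _ _
  · have h1 : IntegrableOn (fun x : ℝ => x ^ (-Y)) (Set.Ioi 1) :=
      integrableOn_Ioi_rpow_of_lt (by linarith) one_pos
    refine h1.mono' hm.aestronglyMeasurable ?_
    filter_upwards [ae_restrict_mem measurableSet_Ioi] with x hx
    rw [h0 x (one_pos.trans hx)]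
    exact min_le_right _ _

/-- A majorant uniform in `h ≤ 1`. For `|y| ≤ 1` the compensator is always active and the integrand
factor is quadratic, giving `|y|^(1-Y)`, integrable at `0` when `Y < 2`. For `|y| ≥ 1` a linear
bound holds with or without the compensator, giving `|y|^(-Y)`, integrable at infinity when `Y > 1`.
-/
theorem norm_cgmyDensity_smul_compensatedExp_le {C G M Y h : ℝ} (hC : 0 ≤ C) (hG : 0 ≤ G)
    (hM : 0 ≤ M) (hY : 0 < Y) (hh : 0 < h) (h1 : h ≤ 1) (u y : ℝ) :
    ‖cgmyDensity C G M Y y • compensatedExp h u y‖ ≤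
      2 * C * (|u| + u ^ 2) * min (|y| ^ (1 - Y)) (|y| ^ (-Y)) := by
  rcases eq_or_ne y 0 with rfl | hy
  · have : cgmyDensity C G M Y 0 = 0 := by simp [cgmyDensity]
    rw [this, zero_smul, norm_zero]
    positivity
  have hy0 : 0 < |y| := abs_pos.2 hy
  rw [norm_smul, Real.norm_of_nonneg (cgmyDensity_nonneg hC G M Y y)]
  have e1 : |y| ^ (1 - Y) = 1 / |y| ^ (1 + Y) * |y| ^ 2 := by
    rw [one_div, ← Real.rpow_neg hy0.le, ← Real.rpow_natCast, ← Real.rpow_add hy0]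
    norm_num; ring_nf
  have e2 : |y| ^ (-Y) = 1 / |y| ^ (1 + Y) * |y| := by
    rw [one_div, ← Real.rpow_neg hy0.le, ← Real.rpow_add_one hy0.ne']
    norm_num
  have hp : 0 < 1 / |y| ^ (1 + Y) := by positivity
  rw [e1, e2, ← mul_min_of_nonneg _ _ hp.le]
  have hb : ‖compensatedExp h u y‖ ≤ 2 * (|u| + u ^ 2) * min (|y| ^ 2) |y| := by
    rcases le_total |y| 1 with hle | hle
    · rw [min_eq_left (by nlinarith)]
      refine (norm_compensatedExp_le_sq hh h1 u hle).trans ?_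
      gcongr
      linarith [abs_nonneg u]
    · rw [min_eq_right (by nlinarith)]
      refine (norm_compensatedExp_le h u y).trans ?_
      gcongr
      linarith [sq_nonneg u]
  calc _ ≤ C * (1 / |y| ^ (1 + Y)) * (2 * (|u| + u ^ 2) * min (|y| ^ 2) |y|) := by
        gcongr
        exact cgmyDensity_le hC hG hM hY y
    _ = _ := by ring

theorem tendsto_compensatedExp (u y : ℝ) :
    Tendsto (fun h : ℝ => compensatedExp h u y) (𝓝[>] 0)
      (𝓝 (Complex.exp (Complex.I * u * y) - 1 - Complex.I * u * y)) := by
  refine tendsto_const_nhds.congr' ?_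
  have h1 : ∀ᶠ h in 𝓝[>] (0 : ℝ), |y| ≤ 1 / h := by
    simp only [one_div]
    exact tendsto_inv_nhdsGT_zero.eventually_ge_atTop |y|
  filter_upwards [h1] with h hh
  rw [compensatedExp, if_pos hh]

theorem tendsto_integral_compensatedExp {C G M Y : ℝ} (hC : 0 ≤ C) (hG : 0 ≤ G) (hM : 0 ≤ M)
    (hY1 : 1 < Y) (hY2 : Y < 2) (u : ℝ) :
    Tendsto (fun h : ℝ => ∫ y, cgmyDensity C (G * h) (M * h) Y y • compensatedExp h u y) (𝓝[>] 0)
      (𝓝 (∫ y : ℝ, (C * (1 / |y| ^ (1 + Y))) •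
        (Complex.exp (Complex.I * u * y) - 1 - Complex.I * u * y))) := by
  have hI : ∀ᶠ h in 𝓝[>] (0 : ℝ), h ∈ Set.Ioc (0 : ℝ) 1 := Ioc_mem_nhdsGT one_pos
  refine tendsto_integral_filter_of_dominated_convergence _ ?_ ?_
    ((integrable_min_rpow_abs hY1 hY2).const_mul (2 * C * (|u| + u ^ 2))) ?_
  · exact Eventually.of_forall fun h => ((measurable_cgmyDensity _ _ _ _).smul
      (measurable_compensatedExp h u)).aestronglyMeasurable
  · filter_upwards [hI] with h hh
    exact ae_of_all _ fun y => norm_cgmyDensity_smul_compensatedExp_le hC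
      (mul_nonneg hG hh.1.le) (mul_nonneg hM hh.1.le) (by linarith) hh.1 hh.2 u y
  · refine ae_of_all _ fun y => ?_
    rw [← cgmyDensity_zero_zero C Y y (by linarith)]
    exact ((tendsto_cgmyDensity_mul C G M Y y).mono_left nhdsWithin_le_nhds).smul
      (tendsto_compensatedExp u y)

theorem integrable_stable_compensatedExp {C Y : ℝ} (hC : 0 ≤ C) (hY1 : 1 < Y) (hY2 : Y < 2)
    (u : ℝ) : Integrable (fun y : ℝ => (C * (1 / |y| ^ (1 + Y))) •
        (Complex.exp (Complex.I * u * y) - 1 - Complex.I * u * y)) := by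
  have hI : ∀ᶠ h in 𝓝[>] (0 : ℝ), h ∈ Set.Ioc (0 : ℝ) 1 := Ioc_mem_nhdsGT one_pos
  refine ((integrable_min_rpow_abs hY1 hY2).const_mul (2 * C * (|u| + u ^ 2))).mono'
    (by fun_prop) (ae_of_all _ fun y => ?_)
  -- The uniform majorant, taken at `G = M = 0`, survives the limit `h → 0`.
  refine le_of_tendsto (((tendsto_compensatedExp u y).const_smul _).norm) ?_
  filter_upwards [hI] with h hh
  rw [← cgmyDensity_zero_zero C Y y (by linarith)]
  exact norm_cgmyDensity_smul_compensatedExp_le hC le_rfl le_rfl (by linarith) hh.1 hh.2 u y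

theorem integral_one_sub_cos_mul_rpow_scaled {Y : ℝ} (hY1 : 1 < Y) (hY2 : Y < 2) (u : ℝ) :
    ∫ y in Set.Ioi (0 : ℝ), (1 - Real.cos (u * y)) * (1 / y ^ (1 + Y))
      = |u| ^ Y * (Real.Gamma (-Y) * |Real.cos (Y * Real.pi / 2)|) := by
  rcases eq_or_ne u 0 with rfl | hu
  · simp [Real.zero_rpow (by linarith : Y ≠ 0)]
  have ha : 0 < |u| := abs_pos.2 hu
  have h := integral_comp_mul_left_Ioi
    (fun y : ℝ => (1 - Real.cos y) * (1 / y ^ (1 + Y))) 0 ha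
  rw [mul_zero, integral_one_sub_cos_mul_rpow_eq_Gamma hY1 hY2] at h
  have e : ∀ y ∈ Set.Ioi (0 : ℝ), (1 - Real.cos (u * y)) * (1 / y ^ (1 + Y))
      = |u| ^ (1 + Y) * ((1 - Real.cos (|u| * y)) * (1 / (|u| * y) ^ (1 + Y))) := fun y hy => by
    have hy : 0 < y := hy
    have hc : Real.cos (|u| * y) = Real.cos (u * y) := by
      rw [← Real.cos_abs (u * y), abs_mul, abs_of_pos hy]
    have := Real.rpow_pos_of_pos ha (1 + Y)
    rw [Real.mul_rpow ha.le hy.le, hc]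
    field_simp
  rw [setIntegral_congr_fun measurableSet_Ioi e, integral_const_mul, h, smul_eq_mul,
    add_comm 1 Y, Real.rpow_add_one ha.ne']
  field_simp

/-- Adding the values at `y` and `-y` cancels the linear compensators and leaves `2 cos(uy) - 2`, so
the integral is real and reduces to the half-line. -/
theorem integral_stable_compensatedExp {C Y : ℝ} (hC : 0 ≤ C) (hY1 : 1 < Y) (hY2 : Y < 2)
    (u : ℝ) : ∫ y : ℝ, (C * (1 / |y| ^ (1 + Y))) •
        (Complex.exp (Complex.I * u * y) - 1 - Complex.I * u * y)
      = ((-2 * C * Real.Gamma (-Y) * |Real.cos (Y * Real.pi / 2)| * |u| ^ Y : ℝ) : ℂ) := by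
  set f : ℝ → ℂ := fun y => (C * (1 / |y| ^ (1 + Y))) •
        (Complex.exp (Complex.I * u * y) - 1 - Complex.I * u * y) with hf
  have hi : Integrable f := integrable_stable_compensatedExp hC hY1 hY2 u
  have h1 : ∀ y, f y + f (-y) =
      ((-2 * C * ((1 - Real.cos (u * |y|)) * (1 / |y| ^ (1 + Y))) : ℝ) : ℂ) := fun y => by
    have hc : Real.cos (u * |y|) = Real.cos (u * y) := by
      rw [← Real.cos_abs (u * |y|), ← Real.cos_abs (u * y), abs_mul, abs_mul, abs_abs]
    have he : Complex.exp (Complex.I * u * y) + Complex.exp (Complex.I * u * (-y : ℝ))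
        = 2 * (Real.cos (u * y) : ℂ) := by
      push_cast
      rw [Complex.two_cos]
      ring_nf
    rw [hf, hc]
    simp only [abs_neg]
    rw [← smul_add, Complex.real_smul]
    rw [show Complex.exp (Complex.I * u * y) - 1 - Complex.I * u * y +
      (Complex.exp (Complex.I * u * (-y : ℝ)) - 1 - Complex.I * u * (-y : ℝ)) =
      (Complex.exp (Complex.I * u * y) + Complex.exp (Complex.I * u * (-y : ℝ))) - 2 by
        push_cast; ring, he]
    push_cast
    ring
  have h2 : ∫ y, f y + f (-y) = 2 * ∫ y, f y := by
    rw [integral_add hi hi.comp_neg, integral_neg_eq_self]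
    ring
  simp_rw [h1] at h2
  rw [integral_complex_ofReal, integral_const_mul,
    integral_comp_abs (f := fun y => (1 - Real.cos (u * y)) * (1 / y ^ (1 + Y))),
    integral_one_sub_cos_mul_rpow_scaled hY1 hY2] at h2
  refine mul_left_cancel₀ (two_ne_zero (α := ℂ)) (h2.symm.trans ?_)
  push_cast
  ring

theorem tendsto_rpow_mul_levyExponent_cgmyMeasure {C G M Y : ℝ} (hC : 0 ≤ C) (hG : 0 ≤ G)
    (hM : 0 ≤ M) (hY1 : 1 < Y) (hY2 : Y < 2) (b u : ℝ) :
    Tendsto (fun h : ℝ => ((h ^ Y : ℝ) : ℂ) * levyExponent 0 b (cgmyMeasure C G M Y) (u / h))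
      (𝓝[>] 0)
      (𝓝 ((-2 * C * Real.Gamma (-Y) * |Real.cos (Y * Real.pi / 2)| * |u| ^ Y : ℝ) : ℂ)) := by
  have h0 : Tendsto (fun h : ℝ => h ^ (Y - 1)) (𝓝[>] 0) (𝓝 0) := by
    have := (Real.continuousAt_rpow_const 0 (Y - 1) (Or.inr (by linarith))).tendsto
    rw [Real.zero_rpow (by linarith)] at this
    exact this.mono_left nhdsWithin_le_nhds
  have h1 := (((Complex.continuous_ofReal.tendsto 0).comp h0).const_mul
    (Complex.I * b * u)).add (tendsto_integral_compensatedExp hC hG hM hY1 hY2 u)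
  rw [Complex.ofReal_zero, mul_zero, zero_add, integral_stable_compensatedExp hC hY1 hY2] at h1
  refine h1.congr' ?_
  filter_upwards [self_mem_nhdsWithin] with h hh
  exact (rpow_mul_levyExponent_cgmyMeasure hC G M Y b u hh).symm

/-! ### Lévy continuity and absence of atoms. -/

/-- Lévy's continuity theorem, existence part: a pointwise limit of characteristic functions which
is continuous at `0` is a characteristic function. -/
theorem exists_charFun_eq_of_tendsto {μ : ℕ → ProbabilityMeasure ℝ} {f : ℝ → ℂ}
    (hf : ContinuousAt f 0)
    (h : ∀ u, Tendsto (fun n => charFun (μ n : Measure ℝ) u) atTop (𝓝 (f u))) :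
    ∃ μ₀ : ProbabilityMeasure ℝ, ∀ u, charFun (μ₀ : Measure ℝ) u = f u := by
  have ht : IsTightMeasureSet {((ν : ProbabilityMeasure ℝ) : Measure ℝ) | ν ∈ Set.range μ} := by
    convert isTightMeasureSet_of_tendsto_charFun (μ := fun n => (μ n : Measure ℝ)) hf h using 1
    ext ν
    simp
  have hc := isCompact_closure_of_isTightMeasureSet ht
  -- Tightness gives relative compactness (Prokhorov). A limit along one free ultrafilter suffices,
  -- since the characteristic functions already converge along `atTop`.
  obtain ⟨μ₀, -, hμ₀⟩ := hc.ultrafilter_le_nhds ((hyperfilter ℕ).map μ) (by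
    rw [le_principal_iff]
    exact mem_map.2 (univ_mem' fun n => subset_closure (Set.mem_range_self n)))
  have hμ₀' : Tendsto μ (hyperfilter ℕ : Filter ℕ) (𝓝 μ₀) := hμ₀
  refine ⟨μ₀, fun u => ?_⟩
  rw [ProbabilityMeasure.tendsto_iff_forall_integral_rclike_tendsto ℂ] at hμ₀'
  have h1 := hμ₀' (BoundedContinuousFunction.innerProbChar u)
  simp_rw [← charFun_eq_integral_innerProbChar] at h1
  exact tendsto_nhds_unique h1 ((h u).mono_left Nat.hyperfilter_le_atTop)

theorem tendsto_probabilityMeasure_of_tendsto_charFun {ι : Type*} {l : Filter ι}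
    [l.IsCountablyGenerated] {μ : ι → ProbabilityMeasure ℝ} {μ₀ : ProbabilityMeasure ℝ}
    (h : ∀ u, Tendsto (fun n => charFun (μ n : Measure ℝ) u) l
      (𝓝 (charFun (μ₀ : Measure ℝ) u))) :
    Tendsto μ l (𝓝 μ₀) :=
  tendsto_of_seq_tendsto fun _ hx =>
    ProbabilityMeasure.tendsto_of_tendsto_charFun fun u => (h u).comp hx

theorem abs_sinc_mul_abs_le_one (x : ℝ) : |Real.sinc x| * |x| ≤ 1 := by
  rcases eq_or_ne x 0 with rfl | hx
  · simp
  · rw [Real.sinc_of_ne_zero hx, abs_div, div_mul_cancel₀ _ (abs_ne_zero.2 hx)]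
    exact Real.abs_sin_le_one x

theorem tendsto_sinc_mul_atTop (y : ℝ) :
    Tendsto (fun r : ℝ => Real.sinc (r * y)) atTop (𝓝 (Set.indicator {0} (fun _ => (1 : ℝ)) y)) := by
  rcases eq_or_ne y 0 with rfl | hy
  · simp
  · rw [Set.indicator_of_notMem (by simpa using hy)]
    have h0 : Tendsto (fun r : ℝ => |y|⁻¹ * r⁻¹) atTop (𝓝 0) := by
      simpa using tendsto_inv_atTop_zero.const_mul |y|⁻¹
    refine squeeze_zero_norm' ?_ h0
    filter_upwards [eventually_gt_atTop 0] with r hr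
    have h1 := abs_sinc_mul_abs_le_one (r * y)
    have hy0 := abs_pos.2 hy
    rw [abs_mul, abs_of_pos hr, ← le_div_iff₀ (by positivity)] at h1
    rw [Real.norm_eq_abs, ← mul_inv, mul_comm |y|, ← one_div]
    exact h1

/-- A finite measure with integrable characteristic function has no atoms. -/
theorem measure_singleton_eq_zero_of_integrable_charFun {μ : Measure ℝ} [IsFiniteMeasure μ]
    (h : Integrable (charFun μ)) (x : ℝ) : μ {x} = 0 := by
  -- Translating moves the possible atom to `0` and keeps the modulus of the characteristic
  -- function.
  set ν : Measure ℝ := μ.map (· + -x) with hν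
  have hn : ∀ t, ‖charFun ν t‖ = ‖charFun μ t‖ := fun t => by
    rw [hν, charFun_map_add_const, norm_mul, Complex.norm_exp_ofReal_mul_I, mul_one]
  have h1 : Tendsto (fun r : ℝ => ∫ y, Real.sinc (r * y) ∂ν) atTop
      (𝓝 (∫ y, Set.indicator {0} (fun _ => (1 : ℝ)) y ∂ν)) := by
    refine tendsto_integral_filter_of_dominated_convergence (fun _ => 1) ?_ ?_
      (integrable_const _) (ae_of_all _ tendsto_sinc_mul_atTop)
    · exact Eventually.of_forall fun r =>
        (Real.continuous_sinc.comp (by fun_prop)).aestronglyMeasurable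
    · exact Eventually.of_forall fun r => ae_of_all _ fun y => Real.abs_sinc_le_one _
  -- The same integral, which tends to `ν {0}`, is the mean of `charFun ν` over `[-r, r]`, hence at
  -- most `‖charFun μ‖₁ / (2r)`.
  have h2 : Tendsto (fun r : ℝ => ∫ y, Real.sinc (r * y) ∂ν) atTop (𝓝 0) := by
    have h0 : Tendsto (fun r : ℝ => (∫ t, ‖charFun μ t‖) / 2 * r⁻¹) atTop (𝓝 0) := by
      simpa using tendsto_inv_atTop_zero.const_mul ((∫ t, ‖charFun μ t‖) / 2)
    refine squeeze_zero_norm' ?_ h0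
    filter_upwards [eventually_gt_atTop 0] with r hr
    have h3 := congrArg norm (integral_charFun_Icc (μ := ν) hr)
    have h4 : ‖∫ t in -r..r, charFun ν t‖ ≤ ∫ t, ‖charFun μ t‖ := by
      rw [intervalIntegral.integral_of_le (by linarith)]
      refine (norm_integral_le_integral_norm _).trans ?_
      simp_rw [hn]
      exact setIntegral_le_integral h.norm (ae_of_all _ fun _ => norm_nonneg _)
    rw [h3] at h4
    simp only [Complex.norm_mul, Complex.norm_real, Complex.norm_ofNat,
      Real.norm_of_nonneg hr.le] at h4
    rw [← div_eq_mul_inv, le_div_iff₀ hr]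
    linarith
  have h5 := tendsto_nhds_unique h1 h2
  rw [integral_indicator_const _ (measurableSet_singleton 0), smul_eq_mul, mul_one,
    measureReal_eq_zero_iff, hν,
    Measure.map_apply (by fun_prop) (measurableSet_singleton 0)] at h5
  convert h5
  ext y
  simp [← sub_eq_add_neg, sub_eq_zero]

theorem integrable_exp_neg_mul_abs_rpow {κ Y : ℝ} (hκ : 0 < κ) (hY : 0 < Y) :
    Integrable (fun u : ℝ => Real.exp (-κ * |u| ^ Y)) := by
  refine integrable_comp_abs_of_integrableOn (f := fun u : ℝ => Real.exp (-κ * u ^ Y)) ?_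
  simpa using integrableOn_rpow_mul_exp_neg_mul_rpow (s := 0) (by norm_num) hY hκ

/-! ### Recognising the stable law. -/

theorem charFun_map_linear_combination (μ : Measure ℝ) [IsProbabilityMeasure μ] (p q u : ℝ) :
    charFun ((μ.prod μ).map (fun z : ℝ × ℝ => p * z.1 + q * z.2)) u
      = charFun μ (p * u) * charFun μ (q * u) := by
  simp only [charFun_apply_real]
  rw [integral_map (by fun_prop) (by fun_prop), ← integral_prod_mul]
  congr 1
  ext z
  rw [← Complex.exp_add]
  push_cast
  ring_nf

/-- A law with characteristic function `exp (-|c u| ^ Y)` is symmetric `Y`-stable. -/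
theorem isSymmetricStableLaw_of_charFun {Y c : ℝ} (hY : 0 < Y) (hc : 0 < c) {μ : Measure ℝ}
    [IsProbabilityMeasure μ]
    (h : ∀ u : ℝ, charFun μ u = Complex.exp (-((|c * u| ^ Y : ℝ) : ℂ))) :
    IsSymmetricStableLaw Y c μ where
  scale_pos := hc
  charFun_eq := h
  symm := by
    have : IsProbabilityMeasure (μ.map fun z : ℝ => -z) :=
      Measure.isProbabilityMeasure_map (by fun_prop)
    refine Measure.ext_of_charFun (funext fun u => ?_)
    have := charFun_map_mul (μ := μ) (-1) u
    simp only [neg_one_mul] at this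
    rw [this, h, h, mul_neg, abs_neg]
  stable := by
    refine ⟨fun x hx => ?_, fun p q hp hq => ⟨0, ?_⟩⟩
    -- A Dirac mass has characteristic function of modulus `1`, whereas here the modulus at `1` is
    -- `exp(-c^Y) < 1`.
    · have h1 := congrArg norm (h 1)
      rw [hx, charFun_dirac, Complex.norm_exp_ofReal_mul_I, ← Complex.ofReal_neg,
        Complex.norm_exp, Complex.ofReal_re, mul_one, abs_of_pos hc] at h1
      have h2 : Real.exp (-c ^ Y) < 1 :=
        Real.exp_lt_one_iff.2 (neg_lt_zero.2 (Real.rpow_pos_of_pos hc Y))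
      linarith
    · have i1 : IsProbabilityMeasure
          ((μ.prod μ).map (fun z : ℝ × ℝ => p * z.1 + q * z.2)) :=
        Measure.isProbabilityMeasure_map (by fun_prop)
      have i2 : IsProbabilityMeasure
          (μ.map (fun z : ℝ => (p ^ Y + q ^ Y) ^ (1 / Y) * z + 0)) :=
        Measure.isProbabilityMeasure_map (by fun_prop)
      refine Measure.ext_of_charFun (funext fun u => ?_)
      simp only [add_zero]
      rw [charFun_map_linear_combination, charFun_map_mul, h, h, h, ← Complex.exp_add,
        ← Complex.ofReal_neg, ← Complex.ofReal_neg, ← Complex.ofReal_neg, ← Complex.ofReal_add]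
      congr 2
      have hpY := Real.rpow_pos_of_pos hp Y
      have hqY := Real.rpow_pos_of_pos hq Y
      have e : ((p ^ Y + q ^ Y) ^ (1 / Y)) ^ Y = p ^ Y + q ^ Y := by
        rw [← Real.rpow_mul (by positivity), one_div_mul_cancel hY.ne', Real.rpow_one]
      have hm : ∀ a : ℝ, 0 < a → |c * (a * u)| ^ Y = a ^ Y * |c * u| ^ Y := fun a ha => by
        rw [mul_left_comm, abs_mul, abs_of_pos ha, Real.mul_rpow ha.le (abs_nonneg _)]
      rw [hm p hp, hm q hq, hm _ (by positivity), e]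
      ring

/-! ### The small-time limit of the process. -/

theorem tendsto_rpow_one_div_nhdsGT {Y : ℝ} (hY : 0 < Y) :
    Tendsto (fun t : ℝ≥0 => (t : ℝ) ^ (1 / Y)) (𝓝[>] 0) (𝓝[>] 0) := by
  refine tendsto_nhdsWithin_iff.2 ⟨?_, ?_⟩
  · have h : Continuous (fun t : ℝ≥0 => (t : ℝ) ^ (1 / Y)) :=
      NNReal.continuous_coe.rpow_const fun _ => Or.inr (by positivity)
    have := h.tendsto 0
    rw [NNReal.coe_zero, Real.zero_rpow (by positivity)] at this
    exact this.mono_left nhdsWithin_le_nhds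
  · filter_upwards [self_mem_nhdsWithin] with t ht
    exact Real.rpow_pos_of_pos (NNReal.coe_pos.2 ht) _

theorem tendsto_charFun_cgmy_rescaled {Ω : Type*} [MeasurableSpace Ω] {P : Measure Ω}
    {X : ℝ≥0 → Ω → ℝ} {C G M Y b : ℝ} (hC : 0 ≤ C) (hG : 0 ≤ G) (hM : 0 ≤ M)
    (hY1 : 1 < Y) (hY2 : Y < 2) (hX : HasLevyTriplet X P 0 b (cgmyMeasure C G M Y)) (u : ℝ) :
    Tendsto (fun t : ℝ≥0 => charFun (P.map fun ω => X t ω / (t : ℝ) ^ (1 / Y)) u) (𝓝[>] 0)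
      (𝓝 (Complex.exp
        ((-2 * C * Real.Gamma (-Y) * |Real.cos (Y * Real.pi / 2)| * |u| ^ Y : ℝ)))) := by
  have h1 := (Complex.continuous_exp.tendsto _).comp
    ((tendsto_rpow_mul_levyExponent_cgmyMeasure hC hG hM hY1 hY2 b u).comp
      (tendsto_rpow_one_div_nhdsGT (by linarith : 0 < Y)))
  refine h1.congr' ?_
  filter_upwards [self_mem_nhdsWithin] with t ht
  have e1 : ((t : ℝ) ^ (1 / Y)) ^ Y = t := by
    rw [← Real.rpow_mul t.coe_nonneg, one_div_mul_cancel (by linarith), Real.rpow_one]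
  simp only [Function.comp_apply, e1]
  rw [← hX.charFun_eq]
  simp_rw [div_eq_inv_mul]
  rw [charFun_map_mul_comp (hX.isLevyProcess.measurable t).aemeasurable]

theorem mainTheorem8 {Ω : Type*} [MeasurableSpace Ω] (P : Measure Ω) [IsProbabilityMeasure P]
    (X : ℝ≥0 → Ω → ℝ) (C G M Y : ℝ) (hC : 0 < C) (hG : 0 < G) (hM : 0 < M)
    (hY : Y ∈ Set.Ioo (1 : ℝ) 2) (hX : IsCGMYProcess X P C G M Y) :
    ∃ μ : ProbabilityMeasure ℝ,
      IsSymmetricStableLaw Y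
        ((2 * C * Real.Gamma (-Y) * |Real.cos (Y * Real.pi / 2)|) ^ (1 / Y)) (μ : Measure ℝ) ∧
      (∀ u : ℝ, charFun (μ : Measure ℝ) u =
        Complex.exp ((-2 * C * Real.Gamma (-Y) * |Real.cos (Y * Real.pi / 2)| * |u| ^ Y : ℝ))) ∧
      TendstoInDistribution (fun (t : ℝ≥0) ω => X t ω / (t : ℝ) ^ (1 / Y)) (𝓝[>] 0)
        (fun z : ℝ => z) (fun _ => P) (μ : Measure ℝ) ∧
      ∀ x : ℝ, Tendsto (fun t : ℝ≥0 => P {ω | x < X t ω / (t : ℝ) ^ (1 / Y)}) (𝓝[>] 0)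
        (𝓝 ((μ : Measure ℝ) (Set.Ioi x))) := by
  obtain ⟨hY1, hY2⟩ := hY
  obtain ⟨b, hb⟩ := hX
  have hY0 : 0 < Y := by linarith
  have hκ : 0 < 2 * C * Real.Gamma (-Y) * |Real.cos (Y * Real.pi / 2)| := by
    have h1 := Gamma_neg_pos hY1 hY2
    have h2 := abs_cos_mul_pi_div_two_pos hY1 hY2
    positivity
  have hm : ∀ t : ℝ≥0, Measurable fun ω => X t ω / (t : ℝ) ^ (1 / Y) := fun t =>
    (hb.isLevyProcess.measurable t).div_const _
  have hlim := tendsto_charFun_cgmy_rescaled hC.le hG.le hM.le hY1 hY2 hb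
  set ρ : ℝ≥0 → ProbabilityMeasure ℝ := fun t =>
    ⟨P.map fun ω => X t ω / (t : ℝ) ^ (1 / Y),
      Measure.isProbabilityMeasure_map (hm t).aemeasurable⟩ with hρ
  -- The sequence serves only to construct `μ`; convergence is then proved along the whole filter.
  obtain ⟨s, hs⟩ := exists_seq_tendsto (𝓝[>] (0 : ℝ≥0))
  obtain ⟨μ, hμ⟩ := exists_charFun_eq_of_tendsto (μ := fun n => ρ (s n))
    (f := fun u => Complex.exp
      ((-2 * C * Real.Gamma (-Y) * |Real.cos (Y * Real.pi / 2)| * |u| ^ Y : ℝ)))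
    (by
      have : Continuous fun u : ℝ => |u| ^ Y :=
        continuous_abs.rpow_const fun _ => Or.inr hY0.le
      exact Continuous.continuousAt (by fun_prop)) (fun u => (hlim u).comp hs)
  have hconv : Tendsto ρ (𝓝[>] 0) (𝓝 μ) :=
    tendsto_probabilityMeasure_of_tendsto_charFun fun u => by rw [hμ]; exact hlim u
  -- The frontier of `Set.Ioi x` is `{x}`, so this is the null-frontier condition of the portmanteau
  -- theorem.
  have hatom : ∀ x : ℝ, (μ : Measure ℝ) {x} = 0 := by
    refine measure_singleton_eq_zero_of_integrable_charFun ?_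
    rw [funext hμ]
    refine ((integrable_exp_neg_mul_abs_rpow hκ hY0).ofReal (𝕜 := ℂ)).congr
      (ae_of_all _ fun u => ?_)
    simp
  refine ⟨μ, isSymmetricStableLaw_of_charFun hY0 (by positivity) fun u => ?_, hμ,
    ⟨fun t => (hm t).aemeasurable, aemeasurable_id', ?_⟩, fun x => ?_⟩
  · rw [hμ, abs_mul, Real.mul_rpow (abs_nonneg _) (abs_nonneg _),
      abs_of_pos (Real.rpow_pos_of_pos hκ (1 / Y)),
      ← Real.rpow_mul hκ.le, one_div_mul_cancel hY0.ne', Real.rpow_one, ← Complex.ofReal_neg]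
    congr 2
    ring
  · have hid : (⟨(μ : Measure ℝ).map fun z : ℝ => z,
        Measure.isProbabilityMeasure_map aemeasurable_id'⟩ : ProbabilityMeasure ℝ) = μ :=
      Subtype.ext Measure.map_id'
    rw [hid]
    exact hconv
  · have h := ProbabilityMeasure.tendsto_measure_of_null_frontier_of_tendsto' hconv
      (E := Set.Ioi x) (by rw [frontier_Ioi]; exact hatom x)
    refine h.congr fun t => ?_
    exact Measure.map_apply (hm t) measurableSet_Ioi
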